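/- Let $M$ be a smooth manifold (Hausdorff, $\sigma$-compact, without boundary), $T=TM$, let $H$ be a closed $3$-form, $b$ a $2$-form and $\eta$ a pseudo-Riemannian metric on $M$, all smooth, with Levi-Civita connection $\mathring\nabla$; put $H_b:=H+\mathrm{d}b$. On $T\oplus T^*$ consider the pairing $\langle X+\alpha,Y+\beta\rangle=\alpha(Y)+\beta(X)$, the twisted Dorfman bracket $[X+\alpha,Y+\beta]_H=[X,Y]+\mathcal L_X\beta-\iota_Y\mathrm{d}\alpha+\iota_Y\iota_XH$, the generalized metric $$\mathcal G=\mathcal G(\eta,b)=\begin{pmatrix}1&0\\ b&1\end{pmatrix}\begin{pmatrix}0&\eta^{-1}\\ \eta&0\end{pmatrix}\begin{pmatrix}1&0\\ -b&1\end{pmatrix},$$ with $\pm1$-eigenbundles $C_\pm=\{X+(b\pm\eta)X\}$ and the isomorphisms $\pi_\pm:C_\pm\to T$, $X+\alpha\mapsto X$. Write $u=u_++u_-$ for the decomposition of $u\in\Gamma(T\oplus T^*)$ along $C_+\oplus C_-$, let $[\cdot,\cdot]_{H\pm}$ be the $C_\pm$-component of the bracket, and let $C(X+\alpha)=X+2b(X)-\alpha$,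 which exchanges $C_+$ and $C_-$. The generalized Bismut connection of $\mathcal G$ is $$D_uv=[u_-,v_+]_{H+}+[u_+,v_-]_{H-}+[Cu_-,v_-]_{H-}+[Cu_+,v_+]_{H+}.$$ Let $\sigma=1$ (generalized chiral case) or $\sigma=-1$ (generalized anti-Kähler case), and let $\mathcal J$ be a smooth endomorphism of $T\oplus T^*$ with $\mathcal J^2=\sigma\mathbf 1$, $\langle\mathcal J u,\mathcal J v\rangle=\sigma\langle u,v\rangle$ and $\mathcal J\mathcal G=\mathcal G\mathcal J$; that is, $(\mathcal G,\mathcal J)$ is an almost generalized chiral (anti-Kähler) structure. It is called weakly integrable if $D\mathcal J=0$. Let $J_\pm:=\pi_\pm\mathcal J\pi_\pm^{-1}\in\mathrm{End}(T)$ be the corresponding tangent bundle structures, let $F_\pm(X,Y,Z)=\eta((\mathring\nabla_XJ_\pm)Y,Z)$ be their fundamental tensors, and let $N_\pm(X,Y,Z)=\eta(N_\pm(X,Y),Z)$ be their Nijenhuis tensors, where $N_\pm(X,Y)=[J_\pm X,J_\pm Y]+J_\pm^2[X,Y]-J_\pm([J_\pm X,Y]+[X,J_\pm Y])$. The following are equivalent: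 1. $(\mathcal G,\mathcal J)$ is weakly integrable. 2. For both signs and all vector fields $X,Y,Z$, $$F_\pm(X,Y,Z)=\mp\tfrac12\bigl(H_b(X,J_\pm Y,Z)-H_b(X,Y,J_\pm Z)\bigr).$$ 3. For both signs, $(\eta,J_\pm)$ is an almost chiral (almost anti-Hermitian) structure, i.e. $J_\pm^2=\sigma\mathbf 1$ and $\eta(J_\pm\cdot,J_\pm\cdot)=\sigma\eta$, of class $\mathcal W_3$, i.e. $F_\pm(X,Y,Z)+F_\pm(Y,Z,X)+F_\pm(Z,X,Y)=0$ for all $X,Y,Z$, and for all vector fields $X,Y,Z$ $$N_\pm(X,Y,Z)=\pm2\bigl(H_b^{(2,1)_\pm+(1,2)_\pm}(J_\pm X,Y,J_\pm Z)+H_b^{(2,1)_\pm+(1,2)_\pm}(X,J_\pm Y,J_\pm Z)\bigr).$$ Here $(2,1)_\pm+(1,2)_\pm$ denotes the corresponding component of a $3$-form in the bigrading given by the eigenbundles $T^{(1,0)},T^{(0,1)}$ of $J_\pm$, with eigenvalues $1,-1$ on $T$ if $\sigma=1$, and $i,-i$ on $T\otimes\mathbb C$ if $\sigma=-1$. -/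

import Mathlib

open Bundle VectorField
open scoped Manifold ContDiff

noncomputable section

namespace GenGeom

variable {E : Type*} [NormedAddCommGroup E] [NormedSpace ℝ E] [FiniteDimensional ℝ E]
  {H : Type*} [TopologicalSpace H] (I : ModelWithCorners ℝ E H)
  {M : Type*} [TopologicalSpace M] [ChartedSpace H M] [IsManifold I ∞ M]

instance (x : M) : FiniteDimensional ℝ (TangentSpace I x) :=
  inferInstanceAs (FiniteDimensional ℝ E)

instance (x : M) : T2Space (TangentSpace I x) :=
  inferInstanceAs (T2Space E)

/-! ### Smooth tensor fields -/

/-- The fibre of the generalized tangent bundle `T ⊕ T*` at `x`. -/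
abbrev GenTangent (x : M) : Type _ := TangentSpace I x × (TangentSpace I x →L[ℝ] ℝ)

variable (M)

/-- Smooth vector fields on `M`, i.e. smooth sections of `T`. -/
abbrev VecField : Type _ := ContMDiffSection I E ∞ (TangentSpace I : M → Type _)

/-- Smooth sections of the generalized tangent bundle `T ⊕ T*`. -/
abbrev GenSection : Type _ :=
  ContMDiffSection I (E × (E →L[ℝ] ℝ)) ∞ (fun x : M => GenTangent I x)

/-- Smooth pseudo-Riemannian metrics on `M`, of arbitrary signature. -/
structure PseudoMetric where
  toFun : ∀ x : M, TangentSpace I x →L[ℝ] TangentSpace I x →L[ℝ] ℝ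
  symm' : ∀ (x : M) (v w : TangentSpace I x), toFun x v w = toFun x w v
  nondegenerate' : ∀ (x : M) (v : TangentSpace I x), (∀ w, toFun x v w = 0) → v = 0
  smooth' : ContMDiff I (I.prod 𝓘(ℝ, E →L[ℝ] E →L[ℝ] ℝ)) ∞
    (fun x => TotalSpace.mk' (E →L[ℝ] E →L[ℝ] ℝ) x (toFun x))

/-- Smooth two-forms on `M`. -/
structure TwoForm where
  toFun : ∀ x : M, TangentSpace I x →L[ℝ] TangentSpace I x →L[ℝ] ℝ
  skew' : ∀ (x : M) (v w : TangentSpace I x), toFun x v w = -toFun x w v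
  smooth' : ContMDiff I (I.prod 𝓘(ℝ, E →L[ℝ] E →L[ℝ] ℝ)) ∞
    (fun x => TotalSpace.mk' (E →L[ℝ] E →L[ℝ] ℝ) x (toFun x))

/-- Smooth three-forms on `M`. -/
structure ThreeForm where
  toFun : ∀ x : M, TangentSpace I x →ₗ[ℝ] TangentSpace I x →ₗ[ℝ] TangentSpace I x →ₗ[ℝ] ℝ
  skew₁₂' : ∀ (x : M) (u v w : TangentSpace I x), toFun x u v w = -toFun x v u w
  skew₂₃' : ∀ (x : M) (u v w : TangentSpace I x), toFun x u v w = -toFun x u w v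
  smooth' : ∀ X Y Z : VecField I M, ContMDiff I 𝓘(ℝ, ℝ) ∞ (fun x => toFun x (X x) (Y x) (Z x))

/-- Smooth endomorphisms of the vector bundle `T ⊕ T*`. -/
structure GenEndo where
  toFun : ∀ x : M, GenTangent I x →L[ℝ] GenTangent I x
  smooth' : ContMDiff I (I.prod 𝓘(ℝ, (E × (E →L[ℝ] ℝ)) →L[ℝ] (E × (E →L[ℝ] ℝ)))) ∞
    (fun x => TotalSpace.mk' ((E × (E →L[ℝ] ℝ)) →L[ℝ] (E × (E →L[ℝ] ℝ))) x (toFun x))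

variable {M}

/-! ### Derivatives -/

/-- The derivative `X f` of a function along a vector field. -/
def dirDeriv (X : ∀ x : M, TangentSpace I x) (f : M → ℝ) (x : M) : ℝ := mvfderiv I f x (X x)

open Classical in
/-- The covector at `x` determined by an operation on vector fields which is tensorial at `x`:
it sends `Z x` to `Φ Z` for every `Z` differentiable at `x` (and it is `0` if `Φ` is not tensorial). -/
def toCovector (Φ : (∀ x : M, TangentSpace I x) → ℝ) (x : M) : TangentSpace I x →L[ℝ] ℝ :=
  haveI : IsManifold I (1 + 1) M := .of_le (n := ∞) (by norm_cast)
  if h : TensorialAt I E Φ x then h.mkHom Φ x else 0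

/-- The Lie derivative `L_X β` of a one-form. -/
def lieDeriv (X : ∀ x : M, TangentSpace I x) (β : ∀ x : M, TangentSpace I x →L[ℝ] ℝ) (x : M) :
    TangentSpace I x →L[ℝ] ℝ :=
  toCovector I (fun Z => dirDeriv I X (fun y => β y (Z y)) x - β x (mlieBracket I X Z x)) x

/-- The contraction `ι_Y dα` for a one-form `α`. -/
def contractExtDeriv (Y : ∀ x : M, TangentSpace I x) (α : ∀ x : M, TangentSpace I x →L[ℝ] ℝ)
    (x : M) : TangentSpace I x →L[ℝ] ℝ :=
  toCovector I (fun Z => dirDeriv I Y (fun y => α y (Z y)) x - dirDeriv I Z (fun y => α y (Y y)) x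
    - α x (mlieBracket I Y Z x)) x

variable {I}

/-- The exterior derivative of a two-form, evaluated on vector fields. -/
def TwoForm.extDeriv (b : TwoForm I M) (X Y Z : ∀ x : M, TangentSpace I x) (x : M) : ℝ :=
  dirDeriv I X (fun y => b.toFun y (Y y) (Z y)) x
    - dirDeriv I Y (fun y => b.toFun y (X y) (Z y)) x
    + dirDeriv I Z (fun y => b.toFun y (X y) (Y y)) x
    - b.toFun x (mlieBracket I X Y x) (Z x)
    + b.toFun x (mlieBracket I X Z x) (Y x)
    - b.toFun x (mlieBracket I Y Z x) (X x)

/-- A three-form is closed if its exterior derivative vanishes. -/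
def ThreeForm.IsClosed (h : ThreeForm I M) : Prop :=
  ∀ (W X Y Z : VecField I M) (x : M),
    dirDeriv I W (fun y => h.toFun y (X y) (Y y) (Z y)) x
      - dirDeriv I X (fun y => h.toFun y (W y) (Y y) (Z y)) x
      + dirDeriv I Y (fun y => h.toFun y (W y) (X y) (Z y)) x
      - dirDeriv I Z (fun y => h.toFun y (W y) (X y) (Y y)) x
      - h.toFun x (mlieBracket I W X x) (Y x) (Z x)
      + h.toFun x (mlieBracket I W Y x) (X x) (Z x)
      - h.toFun x (mlieBracket I W Z x) (X x) (Y x)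
      - h.toFun x (mlieBracket I X Y x) (W x) (Z x)
      + h.toFun x (mlieBracket I X Z x) (W x) (Y x)
      - h.toFun x (mlieBracket I Y Z x) (W x) (X x) = 0

/-! ### Pseudo-Riemannian geometry -/

/-- A pseudo-Riemannian metric at `x`, as a bilinear form. -/
def PseudoMetric.bilin (g : PseudoMetric I M) (x : M) :
    LinearMap.BilinForm ℝ (TangentSpace I x) :=
  LinearMap.mk₂ ℝ (fun v w => g.toFun x v w) (by simp) (by simp) (by simp) (by simp)

theorem PseudoMetric.bilin_nondegenerate (g : PseudoMetric I M) (x : M) :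
    (g.bilin x).Nondegenerate := by
  refine ⟨fun v hv => g.nondegenerate' x v hv, fun v hv => g.nondegenerate' x v fun w => ?_⟩
  rw [g.symm']
  exact hv w

/-- The inverse `η⁻¹ : T* → T` of the metric. -/
def PseudoMetric.sharp (g : PseudoMetric I M) (x : M) (α : TangentSpace I x →L[ℝ] ℝ) :
    TangentSpace I x :=
  ((g.bilin x).toDual (g.bilin_nondegenerate x)).symm α.toLinearMap

theorem PseudoMetric.apply_sharp (g : PseudoMetric I M) (x : M) (α : TangentSpace I x →L[ℝ] ℝ) :
    g.toFun x (g.sharp x α) = α := by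
  ext v
  exact LinearMap.BilinForm.apply_toDual_symm_apply (B := g.bilin x)
    (hB := g.bilin_nondegenerate x) α.toLinearMap v

/-- The Levi-Civita connection `∇_X Y`, given by the Koszul formula. -/
def PseudoMetric.leviCivita (g : PseudoMetric I M) (X Y : ∀ x : M, TangentSpace I x) (x : M) :
    TangentSpace I x :=
  g.sharp x ((1 / 2 : ℝ) • toCovector I (fun Z =>
    dirDeriv I X (fun y => g.toFun y (Y y) (Z y)) x
      + dirDeriv I Y (fun y => g.toFun y (X y) (Z y)) x
      - dirDeriv I Z (fun y => g.toFun y (X y) (Y y)) x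
      + g.toFun x (mlieBracket I X Y x) (Z x)
      - g.toFun x (mlieBracket I X Z x) (Y x)
      - g.toFun x (mlieBracket I Y Z x) (X x)) x)

/-- The action of an endomorphism field of `T` on a vector field. -/
def act (J : ∀ x : M, TangentSpace I x →L[ℝ] TangentSpace I x) (X : ∀ x : M, TangentSpace I x)
    (x : M) : TangentSpace I x := J x (X x)

/-- The fundamental tensor `F(X, Y, Z) = η((∇_X J) Y, Z)`. -/
def PseudoMetric.fundamentalTensor (g : PseudoMetric I M)
    (J : ∀ x : M, TangentSpace I x →L[ℝ] TangentSpace I x)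
    (X Y Z : ∀ x : M, TangentSpace I x) (x : M) : ℝ :=
  g.toFun x (g.leviCivita X (act J Y) x - J x (g.leviCivita X Y x)) (Z x)

/-- The Nijenhuis tensor `N(X, Y) = [JX, JY] + J²[X, Y] - J([JX, Y] + [X, JY])`. -/
def nijenhuis (J : ∀ x : M, TangentSpace I x →L[ℝ] TangentSpace I x)
    (X Y : ∀ x : M, TangentSpace I x) (x : M) : TangentSpace I x :=
  mlieBracket I (act J X) (act J Y) x + J x (J x (mlieBracket I X Y x))
    - J x (mlieBracket I (act J X) Y x + mlieBracket I X (act J Y) x)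

/-! ### Generalized geometry -/

/-- The natural pairing `⟨X + α, Y + β⟩ = α(Y) + β(X)` on `T ⊕ T*`. -/
def pairing {x : M} (u v : GenTangent I x) : ℝ := u.2 v.1 + v.2 u.1

/-- The twisted Dorfman bracket
`[X + α, Y + β]_H = [X, Y] + L_X β - ι_Y dα + ι_Y ι_X H`. -/
def dorfman (h : ThreeForm I M) (u v : ∀ x : M, GenTangent I x) (x : M) : GenTangent I x :=
  (mlieBracket I (fun y => (u y).1) (fun y => (v y).1) x,
    lieDeriv I (fun y => (u y).1) (fun y => (v y).2) x
      - contractExtDeriv I (fun y => (v y).1) (fun y => (u y).2) x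
      + (h.toFun x (u x).1 (v x).1).toContinuousLinearMap)

/-- The `b`-field transformation `e^b : X + α ↦ X + α + b(X)`. -/
def expB (b : TwoForm I M) {x : M} (u : GenTangent I x) : GenTangent I x :=
  (u.1, u.2 + b.toFun x u.1)

/-- The inverse `b`-field transformation `e^{-b} : X + α ↦ X + α - b(X)`. -/
def expNegB (b : TwoForm I M) {x : M} (u : GenTangent I x) : GenTangent I x :=
  (u.1, u.2 - b.toFun x u.1)

/-- The generalized metric `𝒢(η, b) = e^b ∘ (X + α ↦ η⁻¹ α + η X) ∘ e^{-b}`. -/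
def genMetric (g : PseudoMetric I M) (b : TwoForm I M) {x : M} (u : GenTangent I x) :
    GenTangent I x :=
  expB b (g.sharp x (expNegB b u).2, g.toFun x (expNegB b u).1)

/-- The para-complex structure `C = e^b ∘ (X + α ↦ X - α) ∘ e^{-b}`, which exchanges the
eigenbundles of `𝒢(η, b)`. -/
def paraC (b : TwoForm I M) {x : M} (u : GenTangent I x) : GenTangent I x :=
  expB b ((expNegB b u).1, -(expNegB b u).2)

/-- The projection `u_± = ½ (u ± 𝒢 u)` of `T ⊕ T*` onto the eigenbundle `C_±` of `𝒢(η, b)`;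
here and below the sign `±` is the argument `ε = ±1`. -/
def projC (g : PseudoMetric I M) (b : TwoForm I M) (ε : ℝ) {x : M} (u : GenTangent I x) :
    GenTangent I x :=
  (1 / 2 : ℝ) • (u + ε • genMetric g b u)

/-- The generalized Bismut connection of `𝒢(η, b)` for the Dorfman bracket twisted by `H`:
`D_u v = [u_-, v_+]_+ + [u_+, v_-]_- + [C u_-, v_-]_- + [C u_+, v_+]_+`. -/
def bismut (h : ThreeForm I M) (g : PseudoMetric I M) (b : TwoForm I M)
    (u v : ∀ x : M, GenTangent I x) (x : M) : GenTangent I x :=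
  projC g b 1 (dorfman h (fun y => projC g b (-1) (u y)) (fun y => projC g b 1 (v y)) x)
    + projC g b (-1) (dorfman h (fun y => projC g b 1 (u y)) (fun y => projC g b (-1) (v y)) x)
    + projC g b (-1)
        (dorfman h (fun y => paraC b (projC g b (-1) (u y))) (fun y => projC g b (-1) (v y)) x)
    + projC g b 1
        (dorfman h (fun y => paraC b (projC g b 1 (u y))) (fun y => projC g b 1 (v y)) x)

/-- The pair `(𝒢(η, b), 𝒥)` is weakly integrable: `D 𝒥 = 0`, i.e. `D_u (𝒥 v) = 𝒥 (D_u v)`. -/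
def WeaklyIntegrable (h : ThreeForm I M) (g : PseudoMetric I M) (b : TwoForm I M)
    (𝒥 : GenEndo I M) : Prop :=
  ∀ (u v : GenSection I M) (x : M),
    bismut h g b u (fun y => 𝒥.toFun y (v y)) x = 𝒥.toFun x (bismut h g b u v x)

/-- The two kinds of commuting pairs considered: generalized chiral and generalized anti-Kähler,
with tangent bundle counterparts chiral and anti-Hermitian. -/
inductive Kind
  | chiral
  | antiKahler

/-- The sign `σ` in `𝒥² = σ 1` and `⟨𝒥 u, 𝒥 v⟩ = σ ⟨u, v⟩`. -/
def Kind.sign : Kind → ℝ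
  | chiral => 1
  | antiKahler => -1

/-- The eigenvalue on `T^{(1,0)}`: it is `1` for product structures and `i` for almost complex
structures. -/
def Kind.eigenvalue : Kind → ℂ
  | chiral => 1
  | antiKahler => Complex.I

/-- `(𝒢(η, b), 𝒥)` is an almost generalized chiral (anti-Kähler) structure: `𝒥` is a generalized
product (anti-complex) structure commuting with `𝒢(η, b)`. -/
structure IsCommutingPair (k : Kind) (g : PseudoMetric I M) (b : TwoForm I M)
    (𝒥 : GenEndo I M) : Prop where
  sq : ∀ (x : M) (u : GenTangent I x), 𝒥.toFun x (𝒥.toFun x u) = k.sign • u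
  pairing_apply : ∀ (x : M) (u v : GenTangent I x),
    pairing (𝒥.toFun x u) (𝒥.toFun x v) = k.sign * pairing u v
  commute : ∀ (x : M) (u : GenTangent I x),
    𝒥.toFun x (genMetric g b u) = genMetric g b (𝒥.toFun x u)

/-- The endomorphism `J_± = π_± 𝒥 π_±⁻¹` of `T`, where `π_± : C_± → T` is the restriction of the
projection to `T`, with inverse `X ↦ X + (b ± η) X`. -/
def inducedEndo (g : PseudoMetric I M) (b : TwoForm I M) (𝒥 : GenEndo I M) (ε : ℝ) (x : M) :
    TangentSpace I x →L[ℝ] TangentSpace I x :=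
  (ContinuousLinearMap.fst ℝ (TangentSpace I x) (TangentSpace I x →L[ℝ] ℝ)) ∘L 𝒥.toFun x ∘L
    ((ContinuousLinearMap.id ℝ (TangentSpace I x)).prod (b.toFun x + ε • g.toFun x))

/-- The flux `H_b = H + db`, evaluated on vector fields. -/
def flux (h : ThreeForm I M) (b : TwoForm I M) (X Y Z : ∀ x : M, TangentSpace I x) (x : M) : ℝ :=
  h.toFun x (X x) (Y x) (Z x) + b.extDeriv X Y Z x

/-- `(η, J)` is an almost chiral (almost anti-Hermitian) structure of class `𝒲₃`. -/
structure IsClassW3 (k : Kind) (g : PseudoMetric I M)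
    (J : ∀ x : M, TangentSpace I x →L[ℝ] TangentSpace I x) : Prop where
  sq : ∀ (x : M) (v : TangentSpace I x), J x (J x v) = k.sign • v
  metric_apply : ∀ (x : M) (v w : TangentSpace I x),
    g.toFun x (J x v) (J x w) = k.sign * g.toFun x v w
  cyclic : ∀ (X Y Z : VecField I M) (x : M),
    g.fundamentalTensor J X Y Z x + g.fundamentalTensor J Y Z X x
      + g.fundamentalTensor J Z X Y x = 0

/-! ### Bigrading of three-forms -/

/-- A section `a + i b` of the complexified tangent bundle, as the pair `(a, b)`. -/
abbrev ComplexField (I : ModelWithCorners ℝ E H) (M : Type*) [TopologicalSpace M]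
    [ChartedSpace H M] : Type _ :=
  (∀ x : M, TangentSpace I x) × (∀ x : M, TangentSpace I x)

/-- The complex trilinear extension of a real trilinear operation on vector fields. -/
def complexify (h : (∀ x : M, TangentSpace I x) → (∀ x : M, TangentSpace I x) →
      (∀ x : M, TangentSpace I x) → M → ℝ)
    (A B C : ComplexField I M) (x : M) : ℂ :=
  ⟨h A.1 B.1 C.1 x - h A.1 B.2 C.2 x - h A.2 B.1 C.2 x - h A.2 B.2 C.1 x,
    h A.2 B.1 C.1 x + h A.1 B.2 C.1 x + h A.1 B.1 C.2 x - h A.2 B.2 C.2 x⟩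

/-- The projection `½ (X + c J X)` of a vector field `X`, where `c` is complex: it is the
projection onto `T^{(1,0)}` (the `l`-eigenbundle of `J`) for `c = l⁻¹`, and onto `T^{(0,1)}` (the
`-l`-eigenbundle) for `c = -l⁻¹`. -/
def typeProj (J : ∀ x : M, TangentSpace I x →L[ℝ] TangentSpace I x) (c : ℂ)
    (X : ∀ x : M, TangentSpace I x) : ComplexField I M :=
  ((1 / 2 : ℝ) • (X + c.re • act J X), (1 / 2 : ℝ) • (c.im • act J X))

/-- The `(2,1) + (1,2)` component, with respect to `J`, of a three-form. -/
def mixedPart (k : Kind) (J : ∀ x : M, TangentSpace I x →L[ℝ] TangentSpace I x)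
    (h : (∀ x : M, TangentSpace I x) → (∀ x : M, TangentSpace I x) →
      (∀ x : M, TangentSpace I x) → M → ℝ)
    (X Y Z : ∀ x : M, TangentSpace I x) (x : M) : ℂ :=
  let P := typeProj J k.eigenvalue⁻¹
  let Q := typeProj J (-k.eigenvalue⁻¹)
  (complexify h (P X) (P Y) (Q Z) x + complexify h (P X) (Q Y) (P Z) x
      + complexify h (Q X) (P Y) (P Z) x)
    + (complexify h (P X) (Q Y) (Q Z) x + complexify h (Q X) (P Y) (Q Z) x
      + complexify h (Q X) (Q Y) (P Z) x)

end GenGeom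

end

open GenGeom

open Bundle VectorField
open scoped Manifold ContDiff

noncomputable section

set_option linter.unusedSectionVars false

namespace GenGeom

section Smoothness

variable {E : Type*} [NormedAddCommGroup E] [NormedSpace ℝ E] [FiniteDimensional ℝ E]
  {H : Type*} [TopologicalSpace H] {I : ModelWithCorners ℝ E H}
  {M : Type*} [TopologicalSpace M] [ChartedSpace H M] [IsManifold I ∞ M]

variable (I) in
/-- Smoothness of a field of covectors. -/
abbrev SmoothCovector (α : ∀ x : M, TangentSpace I x →L[ℝ] ℝ) :
    Prop :=
  ContMDiff I (I.prod 𝓘(ℝ, E →L[ℝ] ℝ)) ∞ (fun x => TotalSpace.mk' (E →L[ℝ] ℝ) x (α x))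

variable (I) in
/-- Smoothness of a vector field. -/
abbrev SmoothVector (X : ∀ x : M, TangentSpace I x) : Prop :=
  ContMDiff I (I.prod 𝓘(ℝ, E)) ∞ (fun x => TotalSpace.mk' E x (X x))

variable (I) in
/-- Differentiability of a vector field at a point. -/
abbrev DiffVectorAt (X : ∀ x : M, TangentSpace I x) (x : M) : Prop :=
  MDifferentiableAt I (I.prod 𝓘(ℝ, E)) (fun x => TotalSpace.mk' E x (X x)) x

theorem SmoothVector.diffAt {X : ∀ x : M, TangentSpace I x} (hX : SmoothVector I X) (x : M) :
    DiffVectorAt I X x :=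
  (hX x).mdifferentiableAt (by simp)

theorem VecField.smooth (X : VecField I M) : SmoothVector I X := X.contMDiff

/-- Every tangent vector extends to a global smooth vector field. -/
theorem exists_vecField_eq [T2Space M] (x : M) (v : TangentSpace I x) :
    ∃ X : VecField I M, X x = v := by
  obtain ⟨s, hs, hsmooth⟩ :=
    FiberBundle.exists_contMDiffOn_extend (k := ∞) I E (V := (TangentSpace I : M → Type _)) v
  obtain ⟨u, hus, huo, hxu⟩ := mem_nhds_iff.1 hs
  obtain ⟨f, hf⟩ := (SmoothBumpFunction.nhds_basis_tsupport (I := I) x).mem_iff.1 (huo.mem_nhds hxu)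
  have hf := hf.2
  refine ⟨⟨(f : M → ℝ) • FiberBundle.extend E v, ?_⟩, ?_⟩
  · exact ContMDiffOn.smul_section_of_tsupport f.contMDiff.contMDiffOn huo hf (hsmooth.mono hus)
  · simp

theorem smoothCovector_apply {α : ∀ x : M, TangentSpace I x →L[ℝ] ℝ} (hα : SmoothCovector I α)
    {X : ∀ x : M, TangentSpace I x} {x : M} (hX : DiffVectorAt I X x) :
    MDifferentiableAt I 𝓘(ℝ, ℝ) (fun y => α y (X y)) x := by
  have : MDifferentiableAt I (I.prod 𝓘(ℝ, ℝ))
      (fun m ↦ TotalSpace.mk' ℝ (E := Bundle.Trivial M ℝ) m (α m (X m))) x :=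
    MDifferentiableAt.clm_bundle_apply (F₁ := E) ((hα x).mdifferentiableAt (by simp)) hX
  simp only [mdifferentiableAt_totalSpace] at this
  exact this.2

variable (I) in
/-- Smoothness of a field of bilinear forms. -/
abbrev SmoothBilin 
    (B : ∀ x : M, TangentSpace I x →L[ℝ] TangentSpace I x →L[ℝ] ℝ) : Prop :=
  ContMDiff I (I.prod 𝓘(ℝ, E →L[ℝ] E →L[ℝ] ℝ)) ∞
    (fun x => TotalSpace.mk' (E →L[ℝ] E →L[ℝ] ℝ) x (B x))

theorem SmoothBilin.apply {B : ∀ x : M, TangentSpace I x →L[ℝ] TangentSpace I x →L[ℝ] ℝ}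
    (hB : SmoothBilin I B) {X : ∀ x : M, TangentSpace I x} (hX : SmoothVector I X) :
    SmoothCovector I (fun x => B x (X x)) :=
  ContMDiff.clm_bundle_apply (F₁ := E) (F₂ := E →L[ℝ] ℝ)
    (E₂ := fun x : M => TangentSpace I x →L[ℝ] ℝ) hB hX

theorem SmoothBilin.diffAt {B : ∀ x : M, TangentSpace I x →L[ℝ] TangentSpace I x →L[ℝ] ℝ}
    (hB : SmoothBilin I B) {X Y : ∀ x : M, TangentSpace I x} {x : M} (hX : DiffVectorAt I X x)
    (hY : DiffVectorAt I Y x) : MDifferentiableAt I 𝓘(ℝ, ℝ) (fun y => B y (X y) (Y y)) x := by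
  have : MDifferentiableAt I (I.prod 𝓘(ℝ, ℝ))
      (fun m ↦ TotalSpace.mk' ℝ (E := Bundle.Trivial M ℝ) m (B m (X m) (Y m))) x :=
    MDifferentiableAt.clm_bundle_apply₂ (F₁ := E) (F₂ := E)
      ((hB x).mdifferentiableAt (by simp)) hX hY
  simp only [mdifferentiableAt_totalSpace] at this
  exact this.2

theorem contMDiff_genSection_iff {u : ∀ x : M, GenTangent I x} :
    ContMDiff I (I.prod 𝓘(ℝ, E × (E →L[ℝ] ℝ))) ∞
        (fun x => TotalSpace.mk' (E × (E →L[ℝ] ℝ)) (E := fun x : M => GenTangent I x) x (u x)) ↔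
      SmoothVector I (fun x => (u x).1) ∧ SmoothCovector I (fun x => (u x).2) := by
  have key : ∀ x₀ : M, ContMDiffAt I (I.prod 𝓘(ℝ, E × (E →L[ℝ] ℝ))) ∞
        (fun x => TotalSpace.mk' (E × (E →L[ℝ] ℝ)) (E := fun x : M => GenTangent I x) x (u x)) x₀ ↔
      ContMDiffAt I (I.prod 𝓘(ℝ, E)) ∞ (fun x => TotalSpace.mk' E x (u x).1) x₀ ∧
      ContMDiffAt I (I.prod 𝓘(ℝ, E →L[ℝ] ℝ)) ∞
        (fun x => TotalSpace.mk' (E →L[ℝ] ℝ) (E := fun x : M => TangentSpace I x →L[ℝ] ℝ)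
          x (u x).2) x₀ := by
    intro x₀
    rw [contMDiffAt_section, contMDiffAt_section, contMDiffAt_section]
    exact contMDiffAt_prod_module_iff _
  exact ⟨fun h => ⟨fun x => ((key x).1 (h x)).1, fun x => ((key x).1 (h x)).2⟩,
    fun h x => (key x).2 ⟨h.1 x, h.2 x⟩⟩

theorem PseudoMetric.isInvertible (g : PseudoMetric I M) (x : M) : (g.toFun x).IsInvertible := by
  refine ⟨LinearEquiv.toContinuousLinearEquiv
    (LinearEquiv.ofBijective (g.toFun x).toLinearMap ⟨?_, fun α => ⟨g.sharp x α, ?_⟩⟩), rfl⟩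
  · rw [← LinearMap.ker_eq_bot, LinearMap.ker_eq_bot']
    exact fun v hv => g.nondegenerate' x v fun w => by
      simpa using congrArg (fun β : TangentSpace I x →L[ℝ] ℝ => β w) hv
  · exact g.apply_sharp x α

theorem PseudoMetric.ext_left (g : PseudoMetric I M) {x : M} {v w : TangentSpace I x}
    (h : ∀ z, g.toFun x v z = g.toFun x w z) : v = w :=
  sub_eq_zero.1 (g.nondegenerate' x _ fun z => by simp [h])

theorem PseudoMetric.sharp_apply (g : PseudoMetric I M) {x : M} (v : TangentSpace I x) :
    g.sharp x (g.toFun x v) = v :=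
  g.ext_left fun z => by rw [g.apply_sharp]

theorem PseudoMetric.smooth_sharp (g : PseudoMetric I M) {α : ∀ x : M, TangentSpace I x →L[ℝ] ℝ}
    (hα : SmoothCovector I α) : SmoothVector I (fun x => g.sharp x (α x)) := by
  intro x₀
  have hG := ((contMDiffAt_hom_bundle _).1 (g.smooth' x₀)).2
  have hα₀ := (contMDiffAt_section x₀).1 (hα x₀)
  rw [contMDiffAt_section]
  set e := trivializationAt E (TangentSpace I : M → Type _) x₀
  set e' := trivializationAt (E →L[ℝ] ℝ) (fun x : M => TangentSpace I x →L[ℝ] ℝ) x₀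
  have hx : x₀ ∈ e.baseSet := FiberBundle.mem_baseSet_trivializationAt' x₀
  have hx' : x₀ ∈ e'.baseSet := FiberBundle.mem_baseSet_trivializationAt' x₀
  set G : M → E →L[ℝ] E →L[ℝ] ℝ := fun y => ContinuousLinearMap.inCoordinates E (TangentSpace I)
    (E →L[ℝ] ℝ) (fun x : M => TangentSpace I x →L[ℝ] ℝ) x₀ y x₀ y (g.toFun y)
  have hcoord : ∀ y (hy : y ∈ e.baseSet) (hy' : y ∈ e'.baseSet), G y =
      (e'.continuousLinearEquivAt ℝ y hy' : _ →L[ℝ] _) ∘L g.toFun y ∘L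
        ((e.continuousLinearEquivAt ℝ y hy).symm : _ →L[ℝ] _) := fun y hy hy' =>
    ContinuousLinearMap.inCoordinates_eq hy hy'
  have hinv : ∀ y (hy : y ∈ e.baseSet) (hy' : y ∈ e'.baseSet), (G y).IsInvertible := by
    intro y hy hy'
    obtain ⟨f, hf⟩ := g.isInvertible y
    rw [hcoord y hy hy', ← hf]
    exact ⟨((e.continuousLinearEquivAt ℝ y hy).symm.trans f).trans
      (e'.continuousLinearEquivAt ℝ y hy'), rfl⟩
  have hGinv : ContMDiffAt I 𝓘(ℝ, (E →L[ℝ] ℝ) →L[ℝ] E) ∞ (fun y => (G y).inverse) x₀ :=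
    ((hinv x₀ hx hx').contDiffAt_map_inverse).contMDiffAt.comp x₀ hG
  refine (hGinv.clm_apply hα₀).congr_of_eventuallyEq ?_
  filter_upwards [e.open_baseSet.mem_nhds hx, e'.open_baseSet.mem_nhds hx'] with y hy hy'
  have h1 : G y (e ⟨y, g.sharp y (α y)⟩).2 = (e' ⟨y, α y⟩).2 := by
    rw [hcoord y hy hy']
    have : (e ⟨y, g.sharp y (α y)⟩).2 = e.continuousLinearEquivAt ℝ y hy (g.sharp y (α y)) := rfl
    rw [this]
    simp only [ContinuousLinearMap.comp_apply, ContinuousLinearEquiv.coe_coe,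
      ContinuousLinearEquiv.symm_apply_apply, g.apply_sharp]
    rfl
  obtain ⟨f, hf⟩ := hinv y hy hy'
  have h2 : ∀ w, (G y).inverse (G y w) = w := fun w => by
    rw [← hf, ContinuousLinearMap.inverse_equiv]; simp
  exact (h2 _).symm.trans (congrArg _ h1)

end Smoothness

section Derivatives

variable {E : Type*} [NormedAddCommGroup E] [NormedSpace ℝ E] [FiniteDimensional ℝ E]
  {H : Type*} [TopologicalSpace H] {I : ModelWithCorners ℝ E H}
  {M : Type*} [TopologicalSpace M] [ChartedSpace H M] [IsManifold I ∞ M]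

theorem dirDeriv_add {f f' : M → ℝ} {x : M} (hf : MDifferentiableAt I 𝓘(ℝ, ℝ) f x)
    (hf' : MDifferentiableAt I 𝓘(ℝ, ℝ) f' x) (X : ∀ x : M, TangentSpace I x) :
    dirDeriv I X (fun y => f y + f' y) x = dirDeriv I X f x + dirDeriv I X f' x := by
  have := mvfderiv_add hf hf'
  exact congrArg (fun l : TangentSpace I x →L[ℝ] ℝ => l (X x)) this

theorem dirDeriv_mul {f f' : M → ℝ} {x : M} (hf : MDifferentiableAt I 𝓘(ℝ, ℝ) f x)
    (hf' : MDifferentiableAt I 𝓘(ℝ, ℝ) f' x) (X : ∀ x : M, TangentSpace I x) :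
    dirDeriv I X (fun y => f y * f' y) x = f x * dirDeriv I X f' x + f' x * dirDeriv I X f x := by
  have := mvfderiv_mul hf hf'
  exact congrArg (fun l : TangentSpace I x →L[ℝ] ℝ => l (X x)) this

theorem dirDeriv_const_mul {f : M → ℝ} {x : M} (hf : MDifferentiableAt I 𝓘(ℝ, ℝ) f x) (c : ℝ)
    (X : ∀ x : M, TangentSpace I x) :
    dirDeriv I X (fun y => c * f y) x = c * dirDeriv I X f x := by
  rw [dirDeriv_mul mdifferentiableAt_const hf]
  simp [dirDeriv, mvfderiv_const]

theorem dirDeriv_neg (f : M → ℝ) (x : M) (X : ∀ x : M, TangentSpace I x) :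
    dirDeriv I X (fun y => -f y) x = -dirDeriv I X f x := by
  have := mvfderiv_neg (I := I) (g := f) (x := x)
  exact congrArg (fun l : TangentSpace I x →L[ℝ] ℝ => l (X x)) this

theorem dirDeriv_add_left (f : M → ℝ) (x : M) (X Y : ∀ x : M, TangentSpace I x) :
    dirDeriv I (X + Y) f x = dirDeriv I X f x + dirDeriv I Y f x :=
  map_add (mvfderiv I f x) (X x) (Y x)

theorem dirDeriv_smul_left (f : M → ℝ) (x : M) (c : M → ℝ) (X : ∀ x : M, TangentSpace I x) :
    dirDeriv I (c • X) f x = c x * dirDeriv I X f x :=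
  map_smul (mvfderiv I f x) (c x) (X x)

theorem dirDeriv_const_smul_left (f : M → ℝ) (x : M) (c : ℝ) (X : ∀ x : M, TangentSpace I x) :
    dirDeriv I (c • X) f x = c * dirDeriv I X f x :=
  map_smul (mvfderiv I f x) c (X x)

theorem mlieBracket_smul_right_eq {f : M → ℝ} {x : M} (hf : MDifferentiableAt I 𝓘(ℝ, ℝ) f x)
    (X : ∀ x : M, TangentSpace I x) {Z : ∀ x : M, TangentSpace I x} (hZ : DiffVectorAt I Z x) :
    mlieBracket I X (f • Z) x = dirDeriv I X f x • Z x + f x • mlieBracket I X Z x :=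
  mlieBracket_smul_right hf hZ

theorem toCovector_apply {Φ : (∀ x : M, TangentSpace I x) → ℝ} {x : M} (hΦ : TensorialAt I E Φ x)
    {Z : ∀ x : M, TangentSpace I x} (hZ : DiffVectorAt I Z x) :
    toCovector I Φ x (Z x) = Φ Z := by
  have : IsManifold I (1 + 1) M := .of_le (n := ∞) (by norm_cast)
  rw [toCovector, dif_pos hΦ]
  exact TensorialAt.mkHom_apply hΦ hZ

theorem tensorialAt_lieDeriv (X : ∀ x : M, TangentSpace I x)
    {β : ∀ x : M, TangentSpace I x →L[ℝ] ℝ} (hβ : SmoothCovector I β) (x : M) :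
    TensorialAt I E
      (fun Z => dirDeriv I X (fun y => β y (Z y)) x - β x (mlieBracket I X Z x)) x where
  smul {f Z} hf hZ := by
    have h := dirDeriv_mul hf (smoothCovector_apply hβ hZ) X
    simp only [Pi.smul_apply', map_smul, smul_eq_mul, mlieBracket_smul_right_eq hf X hZ, map_add, h]
    ring
  add {Z Z'} hZ hZ' := by
    have h := dirDeriv_add (smoothCovector_apply hβ hZ) (smoothCovector_apply hβ hZ') X
    simp only [Pi.add_apply, map_add, h, mlieBracket_add_right hZ hZ']
    ring

theorem lieDeriv_apply (X : ∀ x : M, TangentSpace I x)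
    {β : ∀ x : M, TangentSpace I x →L[ℝ] ℝ} (hβ : SmoothCovector I β) {x : M}
    {Z : ∀ x : M, TangentSpace I x} (hZ : DiffVectorAt I Z x) :
    lieDeriv I X β x (Z x) =
      dirDeriv I X (fun y => β y (Z y)) x - β x (mlieBracket I X Z x) :=
  toCovector_apply (tensorialAt_lieDeriv X hβ x) hZ

theorem tensorialAt_contractExtDeriv (Y : ∀ x : M, TangentSpace I x)
    {α : ∀ x : M, TangentSpace I x →L[ℝ] ℝ} (hα : SmoothCovector I α) (x : M) :
    TensorialAt I E (fun Z => dirDeriv I Y (fun y => α y (Z y)) x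
      - dirDeriv I Z (fun y => α y (Y y)) x - α x (mlieBracket I Y Z x)) x where
  smul {f Z} hf hZ := by
    have h := dirDeriv_mul hf (smoothCovector_apply hα hZ) Y
    simp only [Pi.smul_apply', map_smul, smul_eq_mul, mlieBracket_smul_right_eq hf Y hZ, map_add, h,
      dirDeriv_smul_left]
    ring
  add {Z Z'} hZ hZ' := by
    have h := dirDeriv_add (smoothCovector_apply hα hZ) (smoothCovector_apply hα hZ') Y
    simp only [Pi.add_apply, map_add, h, mlieBracket_add_right hZ hZ', dirDeriv_add_left]
    ring

theorem contractExtDeriv_apply (Y : ∀ x : M, TangentSpace I x)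
    {α : ∀ x : M, TangentSpace I x →L[ℝ] ℝ} (hα : SmoothCovector I α) {x : M}
    {Z : ∀ x : M, TangentSpace I x} (hZ : DiffVectorAt I Z x) :
    contractExtDeriv I Y α x (Z x) = dirDeriv I Y (fun y => α y (Z y)) x
      - dirDeriv I Z (fun y => α y (Y y)) x - α x (mlieBracket I Y Z x) :=
  toCovector_apply (tensorialAt_contractExtDeriv Y hα x) hZ

theorem PseudoMetric.tensorialAt_koszul (g : PseudoMetric I M) {X Y : ∀ x : M, TangentSpace I x}
    (hX : SmoothVector I X) (hY : SmoothVector I Y) (x : M) :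
    TensorialAt I E (fun Z =>
      dirDeriv I X (fun y => g.toFun y (Y y) (Z y)) x
        + dirDeriv I Y (fun y => g.toFun y (X y) (Z y)) x
        - dirDeriv I Z (fun y => g.toFun y (X y) (Y y)) x
        + g.toFun x (mlieBracket I X Y x) (Z x)
        - g.toFun x (mlieBracket I X Z x) (Y x)
        - g.toFun x (mlieBracket I Y Z x) (X x)) x where
  smul {f Z} hf hZ := by
    have hg : SmoothBilin I g.toFun := g.smooth'
    have h := dirDeriv_mul hf (hg.diffAt (hY.diffAt x) hZ) X
    have h' := dirDeriv_mul hf (hg.diffAt (hX.diffAt x) hZ) Y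
    simp only [Pi.smul_apply', map_smul, smul_eq_mul, mlieBracket_smul_right_eq hf _ hZ, map_add, h,
      h', dirDeriv_smul_left, _root_.add_apply, _root_.smul_apply,
      g.symm' x (Z x)]
    ring
  add {Z Z'} hZ hZ' := by
    have hg : SmoothBilin I g.toFun := g.smooth'
    have h := dirDeriv_add (hg.diffAt (hY.diffAt x) hZ) (hg.diffAt (hY.diffAt x) hZ') X
    have h' := dirDeriv_add (hg.diffAt (hX.diffAt x) hZ) (hg.diffAt (hX.diffAt x) hZ') Y
    simp only [Pi.add_apply, map_add, h, h', mlieBracket_add_right hZ hZ', dirDeriv_add_left,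
      _root_.add_apply]
    ring

/-- The Koszul formula. -/
theorem PseudoMetric.koszul (g : PseudoMetric I M) {X Y Z : ∀ x : M, TangentSpace I x}
    (hX : SmoothVector I X) (hY : SmoothVector I Y) {x : M} (hZ : DiffVectorAt I Z x) :
    g.toFun x (g.leviCivita X Y x) (Z x) = 1 / 2 *
      (dirDeriv I X (fun y => g.toFun y (Y y) (Z y)) x
        + dirDeriv I Y (fun y => g.toFun y (X y) (Z y)) x
        - dirDeriv I Z (fun y => g.toFun y (X y) (Y y)) x
        + g.toFun x (mlieBracket I X Y x) (Z x)
        - g.toFun x (mlieBracket I X Z x) (Y x)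
        - g.toFun x (mlieBracket I Y Z x) (X x)) := by
  rw [PseudoMetric.leviCivita, g.apply_sharp, _root_.smul_apply,
    toCovector_apply (g.tensorialAt_koszul hX hY x) hZ, smul_eq_mul]

variable [T2Space M]

theorem PseudoMetric.ext_vecField (g : PseudoMetric I M) {x : M} {v w : TangentSpace I x}
    (h : ∀ Z : VecField I M, g.toFun x v (Z x) = g.toFun x w (Z x)) : v = w :=
  g.ext_left fun z => by
    obtain ⟨Z, rfl⟩ := exists_vecField_eq x z
    exact h Z

/-- The Levi-Civita connection is torsion-free. -/
theorem PseudoMetric.leviCivita_sub_swap (g : PseudoMetric I M) (X Y : VecField I M) (x : M) :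
    g.leviCivita X Y x - g.leviCivita Y X x = mlieBracket I X Y x := by
  refine g.ext_vecField fun Z => ?_
  rw [map_sub, _root_.sub_apply, g.koszul X.smooth Y.smooth (Z.smooth.diffAt x),
    g.koszul Y.smooth X.smooth (Z.smooth.diffAt x), mlieBracket_swap_apply (V := Y) (W := X)]
  simp only [g.symm' _ (X _) (Y _), map_neg, _root_.neg_apply]
  ring

omit [T2Space M] in
/-- The Levi-Civita connection is metric. -/
theorem PseudoMetric.dirDeriv_apply (g : PseudoMetric I M) (X Y Z : VecField I M) (x : M) :
    dirDeriv I X (fun y => g.toFun y (Y y) (Z y)) x =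
      g.toFun x (g.leviCivita X Y x) (Z x) + g.toFun x (g.leviCivita X Z x) (Y x) := by
  rw [g.koszul X.smooth Y.smooth (Z.smooth.diffAt x), g.koszul X.smooth Z.smooth (Y.smooth.diffAt x),
    mlieBracket_swap_apply (V := Z) (W := Y)]
  simp only [g.symm' _ (Z _) (Y _), map_neg, _root_.neg_apply]
  ring

theorem PseudoMetric.leviCivita_const_smul (g : PseudoMetric I M) (X Y : VecField I M) (c : ℝ)
    (x : M) : g.leviCivita X (c • Y : VecField I M) x = c • g.leviCivita X Y x := by
  have hg : SmoothBilin I g.toFun := g.smooth'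
  refine g.ext_vecField fun Z => ?_
  have h1 := dirDeriv_const_mul (hg.diffAt (Y.smooth.diffAt x) (Z.smooth.diffAt x)) c X
  have h2 := dirDeriv_const_mul (hg.diffAt (X.smooth.diffAt x) (Y.smooth.diffAt x)) c Z
  rw [map_smul, _root_.smul_apply, g.koszul X.smooth Y.smooth (Z.smooth.diffAt x),
    g.koszul X.smooth (c • Y : VecField I M).smooth (Z.smooth.diffAt x)]
  simp only [ContMDiffSection.coe_smul, Pi.smul_apply, dirDeriv_const_smul_left, map_smul,
    _root_.smul_apply, smul_eq_mul, h1, h2,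
    mlieBracket_const_smul_left (Y.smooth.diffAt x),
    mlieBracket_const_smul_right (Y.smooth.diffAt x)]
  ring

end Derivatives

section Algebra

/-- A trilinear operation which is compatible with a structure `J` in its last two arguments and has
vanishing cyclic sum and Nijenhuis tensor is zero. -/
theorem eq_zero_of_cyclic_of_nijenhuis {V : Type*} (J : V → V) {σ : ℝ} (hσ : σ * σ = 1)
    (D : V → V → V → ℝ) (hsymm : ∀ X Y Z, D X Y Z = D X Z Y)
    (hJ : ∀ X Y Z, D X (J Y) Z = -D X Y (J Z))
    (hsq₁ : ∀ X Y Z, D (J (J X)) Y Z = σ * D X Y Z)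
    (hsq₂ : ∀ X Y Z, D X (J (J Y)) Z = σ * D X Y Z)
    (hcyc : ∀ X Y Z, D X Y Z + D Y Z X + D Z X Y = 0)
    (hN : ∀ X Y Z, D (J X) Y Z - D (J Y) X Z + D Y X (J Z) - D X Y (J Z) = 0) (X Y Z : V) :
    D X Y Z = 0 := by
  have hσ0 : σ ≠ 0 := by rintro rfl; simp at hσ
  set A : V → V → V → ℝ := fun X Y Z => σ * D X Y Z + D (J X) (J Y) Z with hA
  have hAsymm : ∀ X Y Z, A X Y Z = A Y X Z := fun X Y Z => by
    have h1 := hN (J X) Y Z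
    rw [hsq₁] at h1
    simp only [hA]
    linear_combination h1 + hJ (J X) Y Z - hJ Y (J X) Z + hsq₂ Y X Z
  have hDA : ∀ X Y Z, 2 * σ * D X Y Z = A X Y Z + A X Z Y := fun X Y Z => by
    simp only [hA]
    linear_combination σ * hsymm X Y Z - hJ (J X) Y Z + hsymm (J X) Y (J Z)
  have hAcyc : ∀ X Y Z, A X Y Z + A Y Z X + A Z X Y = 0 := fun X Y Z => by
    linear_combination σ * hcyc X Y Z - 1 / 2 * (hDA X Y Z + hDA Y Z X + hDA Z X Y)
      + 1 / 2 * (hAsymm X Y Z + hAsymm Y Z X + hAsymm Z X Y)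
  have hA₁ : ∀ X Y Z, A (J X) (J Y) Z = σ * A X Y Z := fun X Y Z => by
    simp only [hA]
    rw [hsq₁, hsq₂]
    ring
  have hA₂ : ∀ X Y Z, A (J X) Y (J Z) = -σ * A X Y Z := fun X Y Z => by
    simp only [hA]
    rw [hsq₁]
    have h := hJ X (J Y) Z
    rw [hsq₂] at h
    linear_combination σ * hJ (J X) Y Z + σ * h
  have hA0 : ∀ X Y Z, A X Y Z = 0 := fun X Y Z => by
    have h1 := hAcyc (J X) (J Y) Z
    rw [hA₁, hA₂, hAsymm Z, hA₂] at h1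
    have h2 := hAcyc X Y Z
    have h3 : σ * A X Y Z = 0 := by linear_combination 1 / 2 * h1 + σ / 2 * h2 - σ / 2 * hAsymm Z X Y
    exact (mul_eq_zero.1 h3).resolve_left hσ0
  have h := hDA X Y Z
  rw [hA0, hA0] at h
  simpa [hσ0] using h

variable {V : Type*} [AddCommGroup V] [Module ℝ V]

/-- The complex trilinear extension of a real trilinear form. -/
def complexifyForm (T : V →ₗ[ℝ] V →ₗ[ℝ] V →ₗ[ℝ] ℝ) (A B C : V × V) : ℂ :=
  ⟨T A.1 B.1 C.1 - T A.1 B.2 C.2 - T A.2 B.1 C.2 - T A.2 B.2 C.1,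
    T A.2 B.1 C.1 + T A.1 B.2 C.1 + T A.1 B.1 C.2 - T A.2 B.2 C.2⟩

/-- The pair of real and imaginary part of `½ (X + c JX)`. -/
def typePair (J : V → V) (c : ℂ) (X : V) : V × V :=
  ((1 / 2 : ℝ) • (X + c.re • J X), (1 / 2 : ℝ) • (c.im • J X))

theorem complexifyForm_mixed (k : Kind) (T : V →ₗ[ℝ] V →ₗ[ℝ] V →ₗ[ℝ] ℝ) (J : V → V) (X Y Z : V) :
    (let P := typePair J k.eigenvalue⁻¹
    let Q := typePair J (-k.eigenvalue⁻¹)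
    (complexifyForm T (P X) (P Y) (Q Z) + complexifyForm T (P X) (Q Y) (P Z)
        + complexifyForm T (Q X) (P Y) (P Z))
      + (complexifyForm T (P X) (Q Y) (Q Z) + complexifyForm T (Q X) (P Y) (Q Z)
        + complexifyForm T (Q X) (Q Y) (P Z))) =
      ((3 / 4 * T X Y Z
        - k.sign / 4 * (T (J X) (J Y) Z + T (J X) Y (J Z) + T X (J Y) (J Z)) : ℝ) : ℂ) := by
  cases k <;> apply Complex.ext <;>
  simp only [complexifyForm, typePair, Kind.eigenvalue, Kind.sign, inv_one, Complex.inv_I, neg_neg,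
    Complex.neg_re, Complex.neg_im, Complex.I_re, Complex.I_im, Complex.one_re, Complex.one_im,
    Complex.add_re, Complex.add_im, Complex.ofReal_re, Complex.ofReal_im, map_add, map_smul,
    LinearMap.add_apply, LinearMap.smul_apply, smul_eq_mul, neg_zero] <;>
  ring

end Algebra

section Flux

variable {E : Type*} [NormedAddCommGroup E] [NormedSpace ℝ E] [FiniteDimensional ℝ E]
  {H : Type*} [TopologicalSpace H] {I : ModelWithCorners ℝ E H}
  {M : Type*} [TopologicalSpace M] [ChartedSpace H M] [IsManifold I ∞ M]
  (h : ThreeForm I M) (b : TwoForm I M)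

theorem flux_swap₁₂ (X Y Z : ∀ x : M, TangentSpace I x) (x : M) :
    flux h b X Y Z x = -flux h b Y X Z x := by
  have h1 := dirDeriv_neg (I := I) (fun y => b.toFun y (Y y) (X y)) x Z
  simp only [flux, TwoForm.extDeriv, h.skew₁₂' x (X x), b.skew' _ (X _) (Y _), h1,
    mlieBracket_swap_apply (V := X) (W := Y), map_neg, _root_.neg_apply]
  ring

theorem flux_swap₂₃ (X Y Z : ∀ x : M, TangentSpace I x) (x : M) :
    flux h b X Y Z x = -flux h b X Z Y x := by
  have h1 := dirDeriv_neg (I := I) (fun y => b.toFun y (Z y) (Y y)) x X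
  simp only [flux, TwoForm.extDeriv, h.skew₂₃' x (X x) (Y x), b.skew' _ (Y _) (Z _), h1,
    mlieBracket_swap_apply (V := Y) (W := Z), map_neg, _root_.neg_apply]
  ring

theorem flux_add₁ (X X' Y Z : VecField I M) (x : M) :
    flux h b (X + X' : VecField I M) Y Z x = flux h b X Y Z x + flux h b X' Y Z x := by
  have hb : SmoothBilin I b.toFun := b.smooth'
  have h1 := dirDeriv_add (hb.diffAt (X.smooth.diffAt x) (Z.smooth.diffAt x))
    (hb.diffAt (X'.smooth.diffAt x) (Z.smooth.diffAt x)) Y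
  have h2 := dirDeriv_add (hb.diffAt (X.smooth.diffAt x) (Y.smooth.diffAt x))
    (hb.diffAt (X'.smooth.diffAt x) (Y.smooth.diffAt x)) Z
  simp only [flux, TwoForm.extDeriv, ContMDiffSection.coe_add, Pi.add_apply, map_add,
    LinearMap.add_apply, _root_.add_apply, dirDeriv_add_left, h1, h2,
    mlieBracket_add_left (X.smooth.diffAt x) (X'.smooth.diffAt x)]
  ring

theorem flux_smul₁ (c : ℝ) (X Y Z : VecField I M) (x : M) :
    flux h b (c • X : VecField I M) Y Z x = c * flux h b X Y Z x := by
  have hb : SmoothBilin I b.toFun := b.smooth'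
  have h1 := dirDeriv_const_mul (hb.diffAt (X.smooth.diffAt x) (Z.smooth.diffAt x)) c Y
  have h2 := dirDeriv_const_mul (hb.diffAt (X.smooth.diffAt x) (Y.smooth.diffAt x)) c Z
  simp only [flux, TwoForm.extDeriv, ContMDiffSection.coe_smul, Pi.smul_apply, map_smul,
    LinearMap.smul_apply, _root_.smul_apply, dirDeriv_const_smul_left, h1, h2, smul_eq_mul,
    mlieBracket_const_smul_left (X.smooth.diffAt x)]
  ring

/-- The flux at a point, as a trilinear form on smooth vector fields. -/
def fluxForm (x : M) :
    VecField I M →ₗ[ℝ] VecField I M →ₗ[ℝ] VecField I M →ₗ[ℝ] ℝ :=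
  have add₂ : ∀ X Y Y' Z : VecField I M,
      flux h b X (Y + Y' : VecField I M) Z x = flux h b X Y Z x + flux h b X Y' Z x := by
    intro X Y Y' Z
    simp only [flux_swap₁₂ h b X, flux_add₁, neg_add]
  have smul₂ : ∀ (c : ℝ) (X Y Z : VecField I M),
      flux h b X (c • Y : VecField I M) Z x = c * flux h b X Y Z x := by
    intro c X Y Z
    simp only [flux_swap₁₂ h b X, flux_smul₁, mul_neg]
  LinearMap.mk₂ ℝ
    (fun X Y =>
      { toFun := fun Z => flux h b X Y Z x
        map_add' := fun Z Z' => by simp only [flux_swap₂₃ h b X Y, add₂, neg_add]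
        map_smul' := fun c Z => by
          simp only [flux_swap₂₃ h b X Y, smul₂, mul_neg, smul_eq_mul, RingHom.id_apply] })
    (fun X X' Y => LinearMap.ext fun Z => flux_add₁ h b X X' Y Z x)
    (fun c X Y => LinearMap.ext fun Z => flux_smul₁ h b c X Y Z x)
    (fun X Y Y' => LinearMap.ext fun Z => add₂ X Y Y' Z)
    (fun c X Y => LinearMap.ext fun Z => smul₂ c X Y Z)

theorem fluxForm_apply (x : M) (X Y Z : VecField I M) :
    fluxForm h b x X Y Z = flux h b X Y Z x := rfl

/-- The vector field `JX`, for an endomorphism field `J` which preserves smoothness. -/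
def actField (J : ∀ x : M, TangentSpace I x →L[ℝ] TangentSpace I x)
    (hJ : ∀ X : VecField I M, SmoothVector I (act J X)) (X : VecField I M) : VecField I M :=
  ⟨act J X, hJ X⟩

theorem mixedPart_flux (k : Kind) {J : ∀ x : M, TangentSpace I x →L[ℝ] TangentSpace I x}
    (hJ : ∀ X : VecField I M, SmoothVector I (act J X)) (X Y Z : VecField I M) (x : M) :
    mixedPart k J (flux h b) X Y Z x =
      ((3 / 4 * flux h b X Y Z x - k.sign / 4 * (flux h b (act J X) (act J Y) Z x
        + flux h b (act J X) Y (act J Z) x + flux h b X (act J Y) (act J Z) x) : ℝ) : ℂ) :=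
  complexifyForm_mixed k (fluxForm h b x) (actField J hJ) X Y Z

end Flux

section Classes

variable {E : Type*} [NormedAddCommGroup E] [NormedSpace ℝ E] [FiniteDimensional ℝ E]
  {H : Type*} [TopologicalSpace H] {I : ModelWithCorners ℝ E H}
  {M : Type*} [TopologicalSpace M] [ChartedSpace H M] [IsManifold I ∞ M]

theorem Kind.sign_mul_self (k : Kind) : k.sign * k.sign = 1 := by cases k <;> simp [Kind.sign]

section Symmetric

variable {k : Kind} {g : PseudoMetric I M} {J : ∀ x : M, TangentSpace I x →L[ℝ] TangentSpace I x}

theorem metric_apply_comm (hsq : ∀ (x : M) (v : TangentSpace I x), J x (J x v) = k.sign • v)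
    (hmet : ∀ (x : M) (v w : TangentSpace I x), g.toFun x (J x v) (J x w) = k.sign * g.toFun x v w)
    (x : M) (v w : TangentSpace I x) : g.toFun x (J x v) w = g.toFun x v (J x w) := by
  have h := hmet x v (J x w)
  rw [hsq, map_smul, smul_eq_mul] at h
  linear_combination k.sign * h - (g.toFun x (J x v) w - g.toFun x v (J x w)) * k.sign_mul_self

variable [T2Space M]

theorem PseudoMetric.leviCivita_const_smul_left (g : PseudoMetric I M) (X Y : VecField I M) (c : ℝ)
    (x : M) : g.leviCivita (c • X : VecField I M) Y x = c • g.leviCivita X Y x := by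
  have h1 := g.leviCivita_sub_swap (c • X) Y x
  have h2 := g.leviCivita_sub_swap X Y x
  rw [g.leviCivita_const_smul, ContMDiffSection.coe_smul,
    mlieBracket_const_smul_left (X.smooth.diffAt x), ← h2] at h1
  exact (sub_eq_iff_eq_add.1 h1).trans (by rw [smul_sub, sub_add_cancel])

variable (hJ : ∀ X : VecField I M, SmoothVector I (act J X))
include hJ

theorem fundamentalTensor_swap
    (hcomm : ∀ (x : M) (v w : TangentSpace I x), g.toFun x (J x v) w = g.toFun x v (J x w))
    (X Y Z : VecField I M) (x : M) :
    g.fundamentalTensor J X Y Z x = g.fundamentalTensor J X Z Y x := by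
  have h1 := g.dirDeriv_apply X (actField J hJ Y) Z x
  have h2 := g.dirDeriv_apply X (actField J hJ Z) Y x
  have h3 : (fun y => g.toFun y (actField J hJ Y y) (Z y)) =
      fun y => g.toFun y (actField J hJ Z y) (Y y) :=
    funext fun y => (hcomm y _ _).trans (g.symm' y _ _)
  rw [h3, h2] at h1
  simp only [PseudoMetric.fundamentalTensor, map_sub, _root_.sub_apply, hcomm]
  simp only [actField, ContMDiffSection.coeFn_mk, act] at h1 ⊢
  linear_combination -h1

theorem fundamentalTensor_act
    (hcomm : ∀ (x : M) (v w : TangentSpace I x), g.toFun x (J x v) w = g.toFun x v (J x w))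
    (hsq : ∀ (x : M) (v : TangentSpace I x), J x (J x v) = k.sign • v)
    (X Y Z : VecField I M) (x : M) :
    g.fundamentalTensor J X (act J Y) Z x = -g.fundamentalTensor J X Y (act J Z) x := by
  have h1 : act J (act J Y) = (k.sign • Y : VecField I M) := funext fun y => hsq y _
  simp only [PseudoMetric.fundamentalTensor, h1, g.leviCivita_const_smul, map_sub,
    _root_.sub_apply, hcomm]
  simp only [act, hsq, map_smul, _root_.smul_apply, smul_eq_mul]
  ring

omit hJ in
theorem fundamentalTensor_const_smul_left (c : ℝ) (X Y Z : VecField I M) (x : M)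
    (hJY : SmoothVector I (act J Y)) :
    g.fundamentalTensor J (c • X : VecField I M) Y Z x = c * g.fundamentalTensor J X Y Z x := by
  have h := g.leviCivita_const_smul_left X ⟨act J Y, hJY⟩ c x
  simp only [ContMDiffSection.coeFn_mk] at h
  simp only [PseudoMetric.fundamentalTensor, h, g.leviCivita_const_smul_left, map_smul, map_sub,
    _root_.smul_apply, _root_.sub_apply, smul_eq_mul]
  ring

theorem metric_nijenhuis
    (hcomm : ∀ (x : M) (v w : TangentSpace I x), g.toFun x (J x v) w = g.toFun x v (J x w))
    (X Y Z : VecField I M) (x : M) :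
    g.toFun x (nijenhuis J X Y x) (Z x) =
      g.fundamentalTensor J (act J X) Y Z x - g.fundamentalTensor J (act J Y) X Z x
        + g.fundamentalTensor J Y X (act J Z) x - g.fundamentalTensor J X Y (act J Z) x := by
  have h1 := g.leviCivita_sub_swap (actField J hJ X) (actField J hJ Y) x
  have h2 := g.leviCivita_sub_swap X Y x
  have h3 := g.leviCivita_sub_swap (actField J hJ X) Y x
  have h4 := g.leviCivita_sub_swap X (actField J hJ Y) x
  simp only [actField, ContMDiffSection.coeFn_mk] at h1 h3 h4
  simp only [nijenhuis, ← h1, ← h2, ← h3, ← h4, PseudoMetric.fundamentalTensor, map_sub, map_add,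
    _root_.sub_apply, _root_.add_apply, hcomm, act]
  ring

/-- For an almost chiral or almost anti-Hermitian structure, the fundamental tensor is given by the
flux if and only if the structure is of class `𝒲₃` with Nijenhuis tensor given by the mixed part of
the flux. -/
theorem fundamentalTensor_eq_flux_iff
    (hsq : ∀ (x : M) (v : TangentSpace I x), J x (J x v) = k.sign • v)
    (hmet : ∀ (x : M) (v w : TangentSpace I x), g.toFun x (J x v) (J x w) = k.sign * g.toFun x v w)
    (h : ThreeForm I M) (b : TwoForm I M) (ε : ℝ) :
    (∀ (X Y Z : VecField I M) (x : M), g.fundamentalTensor J X Y Z x =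
      -ε * (1 / 2) * (flux h b X (act J Y) Z x - flux h b X Y (act J Z) x)) ↔
    IsClassW3 k g J ∧ ∀ (X Y Z : VecField I M) (x : M),
      ((g.toFun x (nijenhuis J X Y x) (Z x) : ℝ) : ℂ) =
        ε * 2 * (mixedPart k J (flux h b) (act J X) Y (act J Z) x
          + mixedPart k J (flux h b) X (act J Y) (act J Z) x) := by
  have hcomm := metric_apply_comm hsq hmet
  set 𝔍 : VecField I M → VecField I M := actField J hJ
  have hact : ∀ X : VecField I M, act J X = 𝔍 X := fun X => rfl
  have hsqV : ∀ X : VecField I M, 𝔍 (𝔍 X) = k.sign • X := fun X =>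
    ContMDiffSection.ext fun y => hsq y _
  have hσ := k.sign_mul_self
  have hsmulV : ∀ (c : ℝ) (X : VecField I M), 𝔍 (c • X) = c • 𝔍 X := fun c X =>
    ContMDiffSection.ext fun y => map_smul (J y) c (X y)
  have hmix : ∀ (X Y Z : VecField I M) (x : M),
      (ε : ℂ) * 2 * (mixedPart k J (flux h b) (𝔍 X) Y (𝔍 Z) x
          + mixedPart k J (flux h b) X (𝔍 Y) (𝔍 Z) x) =
      ((ε * (flux h b (𝔍 X) Y (𝔍 Z) x + flux h b X (𝔍 Y) (𝔍 Z) x - flux h b (𝔍 X) (𝔍 Y) Z x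
        - k.sign * flux h b X Y Z x) : ℝ) : ℂ) := by
    intro X Y Z x
    rw [mixedPart_flux h b k hJ, mixedPart_flux h b k hJ]
    norm_cast
    simp only [hact, hsqV, ← fluxForm_apply, map_smul, LinearMap.smul_apply, smul_eq_mul]
    linear_combination -ε / 2 * (fluxForm h b x X (𝔍 Y) (𝔍 Z) + fluxForm h b x (𝔍 X) Y (𝔍 Z)
      + 2 * fluxForm h b x (𝔍 X) (𝔍 Y) Z + 2 * k.sign * fluxForm h b x X Y Z) * hσ
  have s₁₂ : ∀ (x : M) (X Y Z : VecField I M), fluxForm h b x X Y Z = -fluxForm h b x Y X Z :=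
    fun x X Y Z => flux_swap₁₂ h b X Y Z x
  have s₂₃ : ∀ (x : M) (X Y Z : VecField I M), fluxForm h b x X Y Z = -fluxForm h b x X Z Y :=
    fun x X Y Z => flux_swap₂₃ h b X Y Z x
  have rot : ∀ (x : M) (X Y Z : VecField I M), fluxForm h b x X Y Z = fluxForm h b x Y Z X :=
    fun x X Y Z => by rw [s₁₂, s₂₃, neg_neg]
  simp only [metric_nijenhuis hJ hcomm, hact, hmix, Complex.ofReal_inj]
  constructor
  · intro hF
    refine ⟨⟨hsq, hmet, fun X Y Z x => ?_⟩, fun X Y Z x => ?_⟩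
    · simp only [hF, ← fluxForm_apply]
      linear_combination -ε / 2 * (rot x X (𝔍 Y) Z + rot x (𝔍 Y) Z X - rot x X Y (𝔍 Z)
        - rot x Y Z (𝔍 X))
    · simp only [hF, ← fluxForm_apply, hsqV, map_smul, smul_eq_mul]
      linear_combination ε / 2 * (s₁₂ x (𝔍 Y) (𝔍 X) Z - s₁₂ x (𝔍 Y) X (𝔍 Z) - s₁₂ x Y (𝔍 X) (𝔍 Z)
        + k.sign * s₁₂ x Y X Z)
  · rintro ⟨hW, hN⟩ X Y Z x
    have hFact : ∀ X Y Z : VecField I M, g.fundamentalTensor J X (𝔍 Y) Z x =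
        -g.fundamentalTensor J X Y (𝔍 Z) x := fun X Y Z => fundamentalTensor_act hJ hcomm hsq X Y Z x
    rw [← sub_eq_zero]
    refine eq_zero_of_cyclic_of_nijenhuis 𝔍 hσ (fun X Y Z => g.fundamentalTensor J X Y Z x -
      -ε * (1 / 2) * (flux h b X (𝔍 Y) Z x - flux h b X Y (𝔍 Z) x)) ?_ ?_ ?_ ?_ ?_ ?_ X Y Z
    all_goals intro X Y Z; simp only [← fluxForm_apply]
    · linear_combination fundamentalTensor_swap hJ hcomm X Y Z x
        + ε / 2 * (s₂₃ x X (𝔍 Y) Z - s₂₃ x X Y (𝔍 Z))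
    · simp only [hFact, hsqV, map_smul, LinearMap.smul_apply, smul_eq_mul]
      ring
    · simp only [hsqV, map_smul, LinearMap.smul_apply, smul_eq_mul,
        fundamentalTensor_const_smul_left k.sign X Y Z x (hJ Y)]
      ring
    · have h1 : g.fundamentalTensor J X (𝔍 (𝔍 Y)) Z x = k.sign * g.fundamentalTensor J X Y Z x := by
        rw [hFact, hFact, hsqV, neg_neg]
        exact map_smul (g.toFun x _) k.sign (Z x)
      rw [h1]
      simp only [hsqV, hsmulV, map_smul, LinearMap.smul_apply, smul_eq_mul]
      ring
    · linear_combination hW.cyclic X Y Z x + ε / 2 * (rot x X (𝔍 Y) Z + rot x (𝔍 Y) Z X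
        - rot x X Y (𝔍 Z) - rot x Y Z (𝔍 X))
    · have h1 := hN X Y Z x
      simp only [← fluxForm_apply] at h1
      simp only [hsqV, map_smul, smul_eq_mul]
      linear_combination h1 - ε / 2 * (s₁₂ x (𝔍 Y) (𝔍 X) Z - s₁₂ x (𝔍 Y) X (𝔍 Z)
        - s₁₂ x Y (𝔍 X) (𝔍 Z) + k.sign * s₁₂ x Y X Z)

end Symmetric

end Classes

section Bismut

variable {E : Type*} [NormedAddCommGroup E] [NormedSpace ℝ E] [FiniteDimensional ℝ E]
  {H : Type*} [TopologicalSpace H] {I : ModelWithCorners ℝ E H}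
  {M : Type*} [TopologicalSpace M] [ChartedSpace H M] [IsManifold I ∞ M]

/-- The isomorphism `π_±⁻¹ : T → C_±`, `X ↦ X + (b ± η) X`. -/
def liftC (g : PseudoMetric I M) (b : TwoForm I M) (ε : ℝ) {x : M} (v : TangentSpace I x) :
    GenTangent I x :=
  (v, b.toFun x v + ε • g.toFun x v)

section Pointwise

variable (g : PseudoMetric I M) (b : TwoForm I M) {x : M}

theorem PseudoMetric.sharp_eq_iff {α : TangentSpace I x →L[ℝ] ℝ} {v : TangentSpace I x} :
    g.sharp x α = v ↔ α = g.toFun x v := by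
  constructor
  · rintro rfl
    rw [g.apply_sharp]
  · rintro rfl
    exact g.sharp_apply v

theorem genMetric_fst (u : GenTangent I x) :
    (genMetric g b u).1 = g.sharp x (u.2 - b.toFun x u.1) := rfl

theorem genMetric_snd (u : GenTangent I x) :
    (genMetric g b u).2 = g.toFun x u.1 + b.toFun x (g.sharp x (u.2 - b.toFun x u.1)) := rfl

theorem projC_eq_liftC {ε : ℝ} (hε : ε * ε = 1) (u : GenTangent I x) :
    projC g b ε u = liftC g b ε (projC g b ε u).1 := by
  refine Prod.ext rfl ?_
  simp only [projC, liftC, Prod.smul_fst, Prod.smul_snd, Prod.fst_add, Prod.snd_add,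
    genMetric_fst, genMetric_snd, map_smul, map_add, g.apply_sharp, smul_add, smul_sub, smul_smul]
  ext w
  simp only [_root_.add_apply, _root_.sub_apply, _root_.smul_apply, smul_eq_mul]
  linear_combination (-1 / 2) * (u.2 w - b.toFun x u.1 w) * hε

theorem eq_liftC_add_liftC (u : GenTangent I x) :
    u = liftC g b 1 (projC g b 1 u).1 + liftC g b (-1) (projC g b (-1) u).1 := by
  rw [← projC_eq_liftC g b (by norm_num), ← projC_eq_liftC g b (by norm_num), projC, projC]
  module

theorem liftC_add_liftC_injective {v w v' w' : TangentSpace I x}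
    (h : liftC g b 1 v + liftC g b (-1) w = liftC g b 1 v' + liftC g b (-1) w') :
    v = v' ∧ w = w' := by
  have h1 : v + w = v' + w' := congrArg Prod.fst h
  have h2 := congrArg Prod.snd h
  simp only [liftC, Prod.snd_add] at h2
  have h3 : v - w = v' - w' := g.ext_left fun z => by
    have h4 := congrArg (fun α : TangentSpace I x →L[ℝ] ℝ => α z) h2
    have h5 := congrArg (fun u => b.toFun x u z) h1
    simp only [map_add, map_sub, _root_.add_apply, _root_.sub_apply, _root_.smul_apply,
      smul_eq_mul] at h4 h5 ⊢
    linear_combination h4 - h5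
  constructor
  · have h4 : ∀ p q : TangentSpace I x, p = (1 / 2 : ℝ) • ((p + q) + (p - q)) := fun p q => by module
    rw [h4 v w, h1, h3, ← h4]
  · have h4 : ∀ p q : TangentSpace I x, q = (1 / 2 : ℝ) • ((p + q) - (p - q)) := fun p q => by module
    rw [h4 v w, h1, h3, ← h4]

theorem projC_liftC_add_liftC {ε : ℝ} (hε : ε = 1 ∨ ε = -1) (v w : TangentSpace I x) :
    projC g b ε (liftC g b 1 v + liftC g b (-1) w) = liftC g b ε (if ε = 1 then v else w) := by
  have h := liftC_add_liftC_injective g b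
    (eq_liftC_add_liftC g b (liftC g b 1 v + liftC g b (-1) w))
  rcases hε with rfl | rfl
  · rw [projC_eq_liftC g b (by norm_num), ← h.1, if_pos rfl]
  · rw [projC_eq_liftC g b (by norm_num), ← h.2, if_neg (by norm_num)]

theorem genMetric_liftC {ε : ℝ} (hε : ε * ε = 1) (v : TangentSpace I x) :
    genMetric g b (liftC g b ε v) = ε • liftC g b ε v := by
  have h : g.sharp x ((liftC g b ε v).2 - b.toFun x (liftC g b ε v).1) = ε • v := by
    rw [g.sharp_eq_iff]
    simp [liftC]
  refine Prod.ext h ?_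
  rw [genMetric_snd, h]
  simp only [liftC, map_smul, Prod.smul_snd, smul_add, smul_smul, hε, one_smul]
  exact add_comm _ _

theorem projC_of_genMetric {ε : ℝ} (hε : ε * ε = 1) {u : GenTangent I x}
    (hu : genMetric g b u = ε • u) : projC g b ε u = u := by
  rw [projC, hu, smul_smul, hε]
  module

theorem paraC_liftC (ε : ℝ) (v : TangentSpace I x) :
    paraC b (liftC g b ε v) = liftC g b (-ε) v := by
  refine Prod.ext rfl ?_
  ext w
  simp only [paraC, expB, expNegB, liftC, _root_.add_apply, _root_.sub_apply, _root_.neg_apply,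
    _root_.smul_apply, smul_eq_mul]
  ring

theorem pairing_liftC (ε : ℝ) (v w : TangentSpace I x) :
    pairing (liftC g b ε v) (liftC g b ε w) = 2 * ε * g.toFun x v w := by
  simp only [pairing, liftC, _root_.add_apply, _root_.smul_apply, smul_eq_mul, b.skew' x w v,
    g.symm' x w v]
  ring

theorem metric_projC_fst (ε : ℝ) (u : GenTangent I x) (z : TangentSpace I x) :
    g.toFun x (projC g b ε u).1 z =
      1 / 2 * (g.toFun x u.1 z + ε * (u.2 z - b.toFun x u.1 z)) := by
  simp only [projC, Prod.smul_fst, Prod.fst_add, genMetric_fst, map_smul, map_add, g.apply_sharp,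
    _root_.smul_apply, _root_.add_apply, _root_.sub_apply, smul_eq_mul]

end Pointwise

theorem SmoothVector.liftC (g : PseudoMetric I M) (b : TwoForm I M) (ε : ℝ)
    {X : ∀ x : M, TangentSpace I x} (hX : SmoothVector I X) :
    SmoothCovector I (fun x => (liftC g b ε (X x)).2) := by
  have hb : SmoothBilin I b.toFun := b.smooth'
  have hg : SmoothBilin I g.toFun := g.smooth'
  exact ContMDiff.add_section (V := fun x : M => TangentSpace I x →L[ℝ] ℝ) (hb.apply hX)
    (ContMDiff.const_smul_section (V := fun x : M => TangentSpace I x →L[ℝ] ℝ) (hg.apply hX))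

theorem GenSection.smooth_projC (g : PseudoMetric I M) (b : TwoForm I M) (ε : ℝ)
    (u : GenSection I M) : SmoothVector I (fun x => (projC g b ε (u x)).1) := by
  have hb : SmoothBilin I b.toFun := b.smooth'
  obtain ⟨h1, h2⟩ := contMDiff_genSection_iff.1 u.contMDiff
  have h3 := g.smooth_sharp (ContMDiff.sub_section (V := fun x : M => TangentSpace I x →L[ℝ] ℝ)
    h2 (hb.apply h1))
  exact ContMDiff.const_smul_section (V := (TangentSpace I : M → Type _)) (h1.add_section
    (V := (TangentSpace I : M → Type _))
    (ContMDiff.const_smul_section (V := (TangentSpace I : M → Type _)) h3))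

/-- The component `C_±` of the bracket of sections of `C_∓` and `C_±`, viewed as an operation on
vector fields: it is the metric connection with skew torsion `± H_b`. -/
def tangentBismut (h : ThreeForm I M) (g : PseudoMetric I M) (b : TwoForm I M) (ε : ℝ)
    (X Y : ∀ x : M, TangentSpace I x) (x : M) : TangentSpace I x :=
  (projC g b ε (dorfman h (fun y => liftC g b (-ε) (X y)) (fun y => liftC g b ε (Y y)) x)).1

variable (h : ThreeForm I M) (g : PseudoMetric I M) (b : TwoForm I M)

theorem metric_tangentBismut {ε : ℝ} (hε : ε * ε = 1) (X Y Z : VecField I M) (x : M) :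
    g.toFun x (tangentBismut h g b ε X Y x) (Z x) =
      g.toFun x (g.leviCivita X Y x) (Z x) + ε / 2 * flux h b X Y Z x := by
  have hb : SmoothBilin I b.toFun := b.smooth'
  have hg : SmoothBilin I g.toFun := g.smooth'
  have hZ := Z.smooth.diffAt x
  have key : ∀ (c : ℝ) (A B C : VecField I M),
      dirDeriv I A (fun y => (liftC g b c (B y)).2 (C y)) x =
        dirDeriv I A (fun y => b.toFun y (B y) (C y)) x
          + c * dirDeriv I A (fun y => g.toFun y (B y) (C y)) x := by
    intro c A B C
    have hg' := hg.diffAt (B.smooth.diffAt x) (C.smooth.diffAt x)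
    rw [← dirDeriv_const_mul hg',
      ← dirDeriv_add (hb.diffAt (B.smooth.diffAt x) (C.smooth.diffAt x))
        (f' := fun y => c * g.toFun y (B y) (C y)) (mdifferentiableAt_const.mul hg')]
    rfl
  rw [tangentBismut, metric_projC_fst]
  have hd : (dorfman h (fun y => liftC g b (-ε) (X y)) (fun y => liftC g b ε (Y y)) x).2 (Z x) =
      lieDeriv I X (fun y => (liftC g b ε (Y y)).2) x (Z x)
        - contractExtDeriv I Y (fun y => (liftC g b (-ε) (X y)).2) x (Z x)
        + h.toFun x (X x) (Y x) (Z x) := rfl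
  have hd1 : (dorfman h (fun y => liftC g b (-ε) (X y)) (fun y => liftC g b ε (Y y)) x).1 =
      mlieBracket I X Y x := rfl
  rw [hd, hd1, lieDeriv_apply X (Y.smooth.liftC g b ε) hZ,
    contractExtDeriv_apply Y (X.smooth.liftC g b (-ε)) hZ, key, key, key,
    g.koszul X.smooth Y.smooth hZ, flux, TwoForm.extDeriv]
  simp only [liftC, _root_.add_apply, _root_.smul_apply, smul_eq_mul,
    b.skew' x (mlieBracket I _ _ _) (X x), b.skew' x (mlieBracket I _ _ _) (Y x),
    g.symm' x (mlieBracket I _ _ _) (X x), g.symm' x (mlieBracket I _ _ _) (Y x)]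
  linear_combination (1 / 2) * (dirDeriv I X (fun y => g.toFun y (Y y) (Z y)) x
    + dirDeriv I Y (fun y => g.toFun y (X y) (Z y)) x
    - dirDeriv I Z (fun y => g.toFun y (X y) (Y y)) x
    - g.toFun x (Y x) (mlieBracket I X Z x) - g.toFun x (X x) (mlieBracket I Y Z x)) * hε

theorem tangentBismut_zero_left [T2Space M] {ε : ℝ} (hε : ε * ε = 1) (Y : VecField I M) (x : M) :
    tangentBismut h g b ε (0 : VecField I M) Y x = 0 := by
  refine g.ext_vecField fun Z => ?_
  rw [metric_tangentBismut h g b hε, ← zero_smul ℝ (0 : VecField I M),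
    g.leviCivita_const_smul_left, flux_smul₁]
  simp

/-- The generalized Bismut connection is given on `C_±` by the connections with torsion `± H_b`. -/
theorem bismut_liftC (X X' Y Y' : ∀ x : M, TangentSpace I x) (x : M) :
    bismut h g b (fun y => liftC g b 1 (X y) + liftC g b (-1) (X' y))
        (fun y => liftC g b 1 (Y y) + liftC g b (-1) (Y' y)) x =
      liftC g b 1 (tangentBismut h g b 1 X' Y x + tangentBismut h g b 1 X Y x)
        + liftC g b (-1) (tangentBismut h g b (-1) X Y' x + tangentBismut h g b (-1) X' Y' x) := by
  have hadd : ∀ (ε : ℝ) (v w : TangentSpace I x),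
      liftC g b ε (v + w) = liftC g b ε v + liftC g b ε w := fun ε v w => by
    refine Prod.ext rfl ?_
    simp only [liftC, map_add, smul_add, Prod.snd_add]
    abel
  have hne : (-1 : ℝ) ≠ 1 := by norm_num
  simp only [bismut, projC_liftC_add_liftC g b (Or.inl rfl), projC_liftC_add_liftC g b (Or.inr rfl),
    if_true, if_neg hne, paraC_liftC, neg_neg, hadd, tangentBismut]
  rw [← projC_eq_liftC g b (by norm_num), ← projC_eq_liftC g b (by norm_num),
    ← projC_eq_liftC g b (by norm_num), ← projC_eq_liftC g b (by norm_num)]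
  abel

section Induced

variable {h g b} {k : Kind} {𝒥 : GenEndo I M} (h𝒥 : IsCommutingPair k g b 𝒥)

theorem inducedEndo_apply (ε : ℝ) (x : M) (v : TangentSpace I x) :
    inducedEndo g b 𝒥 ε x v = (𝒥.toFun x (liftC g b ε v)).1 := rfl

include h𝒥

theorem IsCommutingPair.apply_liftC {ε : ℝ} (hε : ε * ε = 1) {x : M} (v : TangentSpace I x) :
    𝒥.toFun x (liftC g b ε v) = liftC g b ε (inducedEndo g b 𝒥 ε x v) := by
  have h1 : genMetric g b (𝒥.toFun x (liftC g b ε v)) = ε • 𝒥.toFun x (liftC g b ε v) := by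
    rw [← h𝒥.commute, genMetric_liftC g b hε, ContinuousLinearMap.map_smul]
  rw [inducedEndo_apply, ← projC_of_genMetric g b hε h1]
  exact projC_eq_liftC g b hε _

theorem IsCommutingPair.inducedEndo_sq {ε : ℝ} (hε : ε * ε = 1) (x : M) (v : TangentSpace I x) :
    inducedEndo g b 𝒥 ε x (inducedEndo g b 𝒥 ε x v) = k.sign • v := by
  rw [inducedEndo_apply ε x (inducedEndo g b 𝒥 ε x v), ← h𝒥.apply_liftC hε, h𝒥.sq]
  rfl

theorem IsCommutingPair.metric_inducedEndo {ε : ℝ} (hε : ε * ε = 1) (x : M)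
    (v w : TangentSpace I x) :
    g.toFun x (inducedEndo g b 𝒥 ε x v) (inducedEndo g b 𝒥 ε x w) =
      k.sign * g.toFun x v w := by
  have h1 := h𝒥.pairing_apply x (liftC g b ε v) (liftC g b ε w)
  rw [h𝒥.apply_liftC hε, h𝒥.apply_liftC hε, pairing_liftC, pairing_liftC] at h1
  linear_combination ε / 2 * h1 - (g.toFun x (inducedEndo g b 𝒥 ε x v) (inducedEndo g b 𝒥 ε x w)
    - k.sign * g.toFun x v w) * hε

omit h𝒥 in
theorem smooth_act_inducedEndo (ε : ℝ) (X : VecField I M) :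
    SmoothVector I (act (inducedEndo g b 𝒥 ε) X) :=
  (contMDiff_genSection_iff.1 (ContMDiff.clm_bundle_apply (F₁ := E × (E →L[ℝ] ℝ))
    (F₂ := E × (E →L[ℝ] ℝ)) (E₁ := fun x : M => GenTangent I x)
    (E₂ := fun x : M => GenTangent I x) 𝒥.smooth'
    (contMDiff_genSection_iff (u := fun x => liftC g b ε (X x)).2
      ⟨X.smooth, X.smooth.liftC g b ε⟩))).1

variable [T2Space M]

theorem IsCommutingPair.weaklyIntegrable_iff_tangentBismut :
    WeaklyIntegrable h g b 𝒥 ↔ ∀ ε : ℝ, ε = 1 ∨ ε = -1 → ∀ (X Y : VecField I M) (x : M),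
      tangentBismut h g b ε X (act (inducedEndo g b 𝒥 ε) Y) x =
        inducedEndo g b 𝒥 ε x (tangentBismut h g b ε X Y x) := by
  have h1 : (1 : ℝ) * 1 = 1 := by norm_num
  have h2 : (-1 : ℝ) * -1 = 1 := by norm_num
  have key : ∀ (X X' Y Y' : VecField I M) (x : M),
      bismut h g b (fun y => liftC g b 1 (X y) + liftC g b (-1) (X' y))
        (fun y => 𝒥.toFun y (liftC g b 1 (Y y) + liftC g b (-1) (Y' y))) x =
      𝒥.toFun x (bismut h g b (fun y => liftC g b 1 (X y) + liftC g b (-1) (X' y))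
        (fun y => liftC g b 1 (Y y) + liftC g b (-1) (Y' y)) x) ↔
      tangentBismut h g b 1 X' (act (inducedEndo g b 𝒥 1) Y) x
          + tangentBismut h g b 1 X (act (inducedEndo g b 𝒥 1) Y) x =
        inducedEndo g b 𝒥 1 x (tangentBismut h g b 1 X' Y x)
          + inducedEndo g b 𝒥 1 x (tangentBismut h g b 1 X Y x) ∧
      tangentBismut h g b (-1) X (act (inducedEndo g b 𝒥 (-1)) Y') x
          + tangentBismut h g b (-1) X' (act (inducedEndo g b 𝒥 (-1)) Y') x =
        inducedEndo g b 𝒥 (-1) x (tangentBismut h g b (-1) X Y' x)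
          + inducedEndo g b 𝒥 (-1) x (tangentBismut h g b (-1) X' Y' x) := by
    intro X X' Y Y' x
    simp only [ContinuousLinearMap.map_add, h𝒥.apply_liftC h1, h𝒥.apply_liftC h2]
    have h3 := bismut_liftC h g b X X' (act (inducedEndo g b 𝒥 1) Y)
      (act (inducedEndo g b 𝒥 (-1)) Y') x
    simp only [act] at h3 ⊢
    rw [h3, bismut_liftC h g b X X' Y Y' x, ContinuousLinearMap.map_add, h𝒥.apply_liftC h1,
      h𝒥.apply_liftC h2, map_add, map_add]
    exact ⟨liftC_add_liftC_injective g b, fun ⟨h4, h5⟩ => by rw [h4, h5]⟩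
  have hsection : ∀ X X' : VecField I M, ∃ u : GenSection I M,
      ⇑u = fun y => liftC g b 1 (X y) + liftC g b (-1) (X' y) := fun X X' =>
    ⟨⟨_, contMDiff_genSection_iff.2 ⟨X.smooth, X.smooth.liftC g b 1⟩⟩
      + ⟨_, contMDiff_genSection_iff.2 ⟨X'.smooth, X'.smooth.liftC g b (-1)⟩⟩, rfl⟩
  have hdecomp : ∀ u : GenSection I M, ∃ X X' : VecField I M,
      ⇑u = fun y => liftC g b 1 (X y) + liftC g b (-1) (X' y) := fun u =>
    ⟨⟨_, GenSection.smooth_projC g b 1 u⟩, ⟨_, GenSection.smooth_projC g b (-1) u⟩,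
      funext fun y => eq_liftC_add_liftC g b (u y)⟩
  have hzero : ∀ (ε : ℝ) (_ : ε * ε = 1) (Y : VecField I M) (x : M),
      tangentBismut h g b ε (0 : VecField I M) (act (inducedEndo g b 𝒥 ε) Y) x = 0 :=
    fun ε hε Y x => tangentBismut_zero_left h g b hε ⟨_, smooth_act_inducedEndo ε Y⟩ x
  constructor
  · intro hw ε hε X Y x
    obtain ⟨u, hu⟩ := hsection X 0
    obtain ⟨v, hv⟩ := hsection Y Y
    have hw' := hw u v x
    simp only [hu, hv] at hw'
    rw [key, hzero 1 h1, hzero (-1) h2, tangentBismut_zero_left h g b h1,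
      tangentBismut_zero_left h g b h2, map_zero, map_zero, zero_add, zero_add, add_zero,
      add_zero] at hw'
    rcases hε with rfl | rfl
    exacts [hw'.1, hw'.2]
  · intro hW u v x
    obtain ⟨X, X', hu⟩ := hdecomp u
    obtain ⟨Y, Y', hv⟩ := hdecomp v
    simp only [hu, hv]
    rw [key, hW 1 (Or.inl rfl), hW 1 (Or.inl rfl), hW (-1) (Or.inr rfl), hW (-1) (Or.inr rfl)]
    exact ⟨rfl, rfl⟩

theorem IsCommutingPair.weaklyIntegrable_iff_fundamentalTensor :
    WeaklyIntegrable h g b 𝒥 ↔ ∀ ε : ℝ, ε = 1 ∨ ε = -1 → ∀ (X Y Z : VecField I M) (x : M),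
      g.fundamentalTensor (inducedEndo g b 𝒥 ε) X Y Z x =
        -ε * (1 / 2) * (flux h b X (act (inducedEndo g b 𝒥 ε) Y) Z x
          - flux h b X Y (act (inducedEndo g b 𝒥 ε) Z) x) := by
  rw [h𝒥.weaklyIntegrable_iff_tangentBismut]
  refine forall₂_congr fun ε hε => forall₂_congr fun X Y => ?_
  have hε' : ε * ε = 1 := by rcases hε with rfl | rfl <;> norm_num
  have hcomm := metric_apply_comm (h𝒥.inducedEndo_sq hε') (h𝒥.metric_inducedEndo hε')
  have key : ∀ (Z : VecField I M) (x : M),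
      g.toFun x (tangentBismut h g b ε X (act (inducedEndo g b 𝒥 ε) Y) x) (Z x)
        - g.toFun x (inducedEndo g b 𝒥 ε x (tangentBismut h g b ε X Y x)) (Z x) =
      g.fundamentalTensor (inducedEndo g b 𝒥 ε) X Y Z x
        + ε / 2 * (flux h b X (act (inducedEndo g b 𝒥 ε) Y) Z x
          - flux h b X Y (act (inducedEndo g b 𝒥 ε) Z) x) := by
    intro Z x
    have h1 := metric_tangentBismut h g b hε' X ⟨_, smooth_act_inducedEndo (g := g) (b := b)
      (𝒥 := 𝒥) ε Y⟩ Z x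
    have h2 := metric_tangentBismut h g b hε' X Y ⟨_, smooth_act_inducedEndo (g := g) (b := b)
      (𝒥 := 𝒥) ε Z⟩ x
    simp only [ContMDiffSection.coeFn_mk] at h1 h2
    rw [h1, hcomm, PseudoMetric.fundamentalTensor, map_sub, _root_.sub_apply, hcomm]
    simp only [act] at h2 ⊢
    rw [h2]
    ring
  constructor
  · intro hW Z x
    have h1 := key Z x
    rw [hW x, sub_self] at h1
    linear_combination -h1
  · intro hF x
    refine g.ext_vecField fun Z => ?_
    rw [← sub_eq_zero, key, hF]
    ring

end Induced

end Bismut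

end GenGeom

end

theorem mainTheorem5
    {E : Type*} [NormedAddCommGroup E] [NormedSpace ℝ E] [FiniteDimensional ℝ E]
    {H : Type*} [TopologicalSpace H] {I : ModelWithCorners ℝ E H}
    {M : Type*} [TopologicalSpace M] [ChartedSpace H M] [IsManifold I ∞ M]
    [BoundarylessManifold I M] [T2Space M] [SigmaCompactSpace M]
    (h : ThreeForm I M) (hclosed : h.IsClosed)
    (g : PseudoMetric I M) (b : TwoForm I M) (k : Kind) (𝒥 : GenEndo I M)
    (h𝒥 : IsCommutingPair k g b 𝒥) :
    (WeaklyIntegrable h g b 𝒥 ↔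
      ∀ ε : ℝ, ε = 1 ∨ ε = -1 → ∀ (X Y Z : VecField I M) (x : M),
        g.fundamentalTensor (inducedEndo g b 𝒥 ε) X Y Z x =
          -ε * (1 / 2) * (flux h b X (act (inducedEndo g b 𝒥 ε) Y) Z x
            - flux h b X Y (act (inducedEndo g b 𝒥 ε) Z) x)) ∧
    (WeaklyIntegrable h g b 𝒥 ↔
      ∀ ε : ℝ, ε = 1 ∨ ε = -1 →
        IsClassW3 k g (inducedEndo g b 𝒥 ε) ∧
        ∀ (X Y Z : VecField I M) (x : M),
          ((g.toFun x (nijenhuis (inducedEndo g b 𝒥 ε) X Y x) (Z x) : ℝ) : ℂ) =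
            ε * 2 *
              (mixedPart k (inducedEndo g b 𝒥 ε) (flux h b)
                  (act (inducedEndo g b 𝒥 ε) X) Y (act (inducedEndo g b 𝒥 ε) Z) x
                + mixedPart k (inducedEndo g b 𝒥 ε) (flux h b)
                  X (act (inducedEndo g b 𝒥 ε) Y) (act (inducedEndo g b 𝒥 ε) Z) x)) := by
  have hiff := h𝒥.weaklyIntegrable_iff_fundamentalTensor (h := h)
  refine ⟨hiff, hiff.trans (forall₂_congr fun ε hε => ?_)⟩
  have hε' : ε * ε = 1 := by rcases hε with rfl | rfl <;> norm_num
  exact fundamentalTensor_eq_flux_iff (smooth_act_inducedEndo ε) (h𝒥.inducedEndo_sq hε')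
    (h𝒥.metric_inducedEndo hε') h b ε
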